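/- Let $0<\alpha<1$, let $\theta=1_{[0,\infty)}$, and let $g_{-\alpha}=\frac{1}{\Gamma(1-\alpha)}D\big(\theta(t)t^{-\alpha}\big)$, where $D$ is the distributional derivative on $\mathbb{R}$. For $T\in(0,\infty]$ and a continuous function $u:[0,T)\to\mathbb{R}$, the generalized Caputo derivative of $u$ (with initial value $u(0)$) is the distribution on $(-\infty,T)$ $$D_c^{\alpha}u=g_{-\alpha}*\big((u-u(0))\theta\big),\qquad \langle D_c^\alpha u,\varphi\rangle=\int_0^{T}(u(s)-u(0))\,\langle g_{-\alpha},\varphi(\cdot+s)\rangle\,ds,\quad \varphi\in C_c^\infty((-\infty,T)).$$ For a continuous function $v$ on $[0,T)$, the relation $D_c^{\alpha}u\ge v$ (resp. $\le v$) in the distributional sense means that $\langle D_c^{\alpha}u,\varphi\rangle\ge\int_0^{T}v\varphi\,dt$ (resp. $\le$) for every nonnegative $\varphi\in C_c^\infty((-\infty,T))$. Theorem 3.1. Let $f:[0,\infty)\times\mathbb{R}\to\mathbb{R}$ be continuous and locally Lipschitz in $u$, that is, every point $(t_0,u_0)\in[0,\infty)\times\mathbb{R}$ has a neighbourhood in $[0,\infty)\times\mathbb{R}$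 on which $|f(t,u)-f(t,v)|\le L|u-v|$ with a constant $L$ independent of $t$. Let $T_y,T_z\in(0,\infty]$ and let $y:[0,T_y)\to\mathbb{R}$ and $z:[0,T_z)\to\mathbb{R}$ be continuous functions such that, in the distributional sense, $$D_c^{\alpha}y\ge f(t,y)\ \text{ on } [0,T_y),\qquad D_c^{\alpha}z\le f(t,z)\ \text{ on } [0,T_z),$$ and $y(0)\ge z(0)$. Then $y(t)\ge z(t)$ for all $t\in[0,\min(T_y,T_z))$. If moreover $y(0)>z(0)$, then $y(t)>z(t)$ for all $t\in[0,\min(T_y,T_z))$. -/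

import Mathlib

open Set MeasureTheory Topology TopologicalSpace
open scoped NNReal Distributions LineDeriv

noncomputable section

namespace FracComparison

/-- The interval of existence `[0, T)`, where `T` may be `+∞`. -/
def existInterval (T : EReal) : Set ℝ := {t : ℝ | 0 ≤ t ∧ (t : EReal) < T}

/-- The open set `(-∞, T)`, where `T` may be `+∞`. Distributions "with support in `[0, T)`" are
distributions on this open set that vanish on negative times. -/
def past (T : EReal) : Opens ℝ where
  carrier := {t : ℝ | (t : EReal) < T}
  is_open' := isOpen_Iio.preimage continuous_coe_real_ereal

/-- The function `θ(t) t ^ β` on the real line, where `θ` is the Heaviside function. -/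
def heavisidePow (β : ℝ) (t : ℝ) : ℝ := if 0 ≤ t then t ^ β else 0

/-- The distribution on `ℝ` (test functions on the whole line) given by integration against a
locally integrable function. -/
def regularDistribution (v : ℝ → ℝ) : 𝓓'((⊤ : Opens ℝ), ℝ) :=
  ContinuousLinearMap.toUniformConvergenceCLM _ _ _
    (TestFunction.integralAgainstBilinCLM (ContinuousLinearMap.mul ℝ ℝ) volume v)

/-- The kernel `g_β = (1 / Γ(1 + β)) D (θ(t) t ^ β)` for `-1 < β < 0`, where `D` is the
distributional derivative on `ℝ`. -/
def abelDistribution (β : ℝ) : 𝓓'((⊤ : Opens ℝ), ℝ) :=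
  (Real.Gamma (1 + β))⁻¹ • ∂_{(1 : ℝ)} (regularDistribution (heavisidePow β))

/-- The translate `x ↦ φ (x + s)` of a test function, as a test function on `ℝ`. -/
def translate {Ω : Opens ℝ} (φ : 𝓓(Ω, ℝ)) (s : ℝ) : 𝓓((⊤ : Opens ℝ), ℝ) where
  toFun x := φ (x + s)
  contDiff' := φ.contDiff.comp (contDiff_id.add contDiff_const)
  hasCompactSupport' := φ.hasCompactSupport.comp_homeomorph (Homeomorph.addRight s)
  tsupport_subset' := fun _ _ => trivial

/-- The convolution `S * (θ v)` of a distribution `S` supported in `[0, ∞)` with the function `θ v`,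
where `v` is locally integrable on `[0, T)`. It is the distribution on `(-∞, T)` given by
`⟨S * (θ v), φ⟩ = ∫_{s ≥ 0} v(s) ⟨S, φ(· + s)⟩ ds`. The values of `v` outside `[0, T)` do not matter,
since `φ(· + s)` vanishes near `[0, ∞)` when `s ≥ T`. -/
def convolve (S : 𝓓'((⊤ : Opens ℝ), ℝ)) (v : ℝ → ℝ) {T : EReal} (φ : 𝓓(past T, ℝ)) : ℝ :=
  ∫ s in Ici (0 : ℝ), v s * S (translate φ s)

/-- The generalized Caputo derivative of order `α` of `u`, associated with the initial value `u₀`: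
the distribution `D_c^α u = g_{-α} * ((u - u₀) θ)` on `(-∞, T)`. -/
def caputo (α : ℝ) (u₀ : ℝ) (u : ℝ → ℝ) {T : EReal} (φ : 𝓓(past T, ℝ)) : ℝ :=
  convolve (abelDistribution (-α)) (fun t => u t - u₀) φ

/-- The distribution on `(-∞, T)` defined by the function `θ v`, for `v` locally integrable on
`[0, T)`. -/
def ofFunction (v : ℝ → ℝ) {T : EReal} (φ : 𝓓(past T, ℝ)) : ℝ :=
  ∫ t in Ici (0 : ℝ), v t * φ t

/-- The inequality `S ≤ R` between distributions on `(-∞, T)`, tested on nonnegative test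
functions. -/
def DistribLE {T : EReal} (S R : 𝓓(past T, ℝ) → ℝ) : Prop :=
  ∀ φ : 𝓓(past T, ℝ), (∀ t, 0 ≤ φ t) → S φ ≤ R φ

/-- `f` is locally Lipschitz in its second variable on `[0, ∞) × ℝ`: every point `(t₀, u₀)` has
a neighbourhood in `[0, ∞) × ℝ` on which `f` is Lipschitz in `u`, with a constant that does not
depend on `t`. -/
def LocallyLipschitzInState (f : ℝ → ℝ → ℝ) : Prop :=
  ∀ t₀ : ℝ, 0 ≤ t₀ → ∀ u₀ : ℝ, ∃ L : ℝ≥0, ∃ N ∈ 𝓝 u₀,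
    ∀ᶠ t in 𝓝[Ici 0] t₀, LipschitzOnWith L (f t) N

end FracComparison

end

/-!
Test both inequalities with `φ(s) = ∫ r(q) ψ(s + q) dq`, where `ψ` is a nonnegative bump and `r`
consists of the first two terms `x ^ (α - 1) / Γ(α) - L x ^ (2 α - 1) / Γ(2 α)` of the
Mittag-Leffler resolvent of `D^α + L`, cut off before it changes sign. Let `k` be the kernel of the
fractional integral of order `1 - α`. By the semigroup law of these kernels before the cut-off, and
because they decrease after it, `Q = θ - k ⋆ r` and `Q - L θ ⋆ r` are monotone. Since
`∫ Q(q) ψ'(s + q) dq ≤ 0` for every monotone `Q`, the Lipschitz term `L |w| φ` for `w = z - y` is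
absorbed, and `|w| + w = 2 w⁺` leaves, on `[0, b]`, the weak inequality
`w ≤ w(0) (1 - Q(b)) + 2 Q' ⋆ w⁺` with `Q(b) < 1`. As `Q` tends to `0` at `0+`, Grönwall iteration
over short steps gives `w⁺ = 0`, and then `w ≤ w(0) (1 - Q(b))` also yields the strict comparison.
-/

noncomputable section

namespace FracComparison

open Filter
open scoped ContDiff Convolution

theorem integrableOn_Ici_of_eq_zero {g : ℝ → ℝ} {a b : ℝ} (hg : ContinuousOn g (Icc a b))
    (hb : ∀ t, b ≤ t → g t = 0) : IntegrableOn g (Ici a) := by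
  refine hg.integrableOn_Icc.of_forall_sdiff_eq_zero measurableSet_Ici fun t ht => hb t ?_
  by_contra! htb
  exact ht.2 ⟨ht.1, htb.le⟩

theorem deriv_eq_zero_of_eq_zero_of_ge {g : ℝ → ℝ} {b : ℝ} (hg : Differentiable ℝ g)
    (hb : ∀ t, b ≤ t → g t = 0) : ∀ t, b ≤ t → deriv g t = 0 := fun t ht => by
  rw [← (hg t).derivWithin (uniqueDiffWithinAt_Ici t),
    derivWithin_congr (f := fun _ => 0)
      (fun s (hs : s ∈ Ici t) => hb s (ht.trans hs)) (hb t ht),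
    derivWithin_fun_const, Pi.zero_apply]

/-- The forward average `s ↦ ∫ h(q) ψ(s + q) dq` of `ψ` with weight `h`, the adjoint of the
convolution with `h`. -/
def forwardAverage (h ψ : ℝ → ℝ) (s : ℝ) : ℝ := ∫ q, h q * ψ (s + q)

section ForwardAverage

variable {h k ψ : ℝ → ℝ} {b : ℝ}

theorem forwardAverage_eq_convolution (h ψ : ℝ → ℝ) :
    forwardAverage h ψ = (fun t => h (-t)) ⋆ ψ := by
  funext s
  rw [forwardAverage, convolution_lsmul, ← integral_neg_eq_self]
  simp only [smul_eq_mul, sub_eq_add_neg]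

theorem locallyIntegrable_comp_neg (hh : LocallyIntegrable h) :
    LocallyIntegrable fun t => h (-t) := by
  rw [← Measure.map_neg_eq_self (volume : Measure ℝ)] at hh
  exact (locallyIntegrable_map_homeomorph (Homeomorph.neg ℝ)).1 hh

theorem integrable_mul_comp_add (hh : LocallyIntegrable h) (hψ : Continuous ψ)
    (hc : HasCompactSupport ψ) (s : ℝ) : Integrable fun q => h q * ψ (s + q) :=
  hh.integrable_smul_right_of_hasCompactSupport (by fun_prop)
    (hc.comp_homeomorph (Homeomorph.addLeft s))

theorem continuous_forwardAverage (hh : LocallyIntegrable h) (hψ : Continuous ψ)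
    (hc : HasCompactSupport ψ) : Continuous (forwardAverage h ψ) := by
  rw [forwardAverage_eq_convolution]
  exact hc.continuous_convolution_right _ (locallyIntegrable_comp_neg hh) hψ

theorem contDiff_forwardAverage {n : ℕ∞} (hh : LocallyIntegrable h) (hψ : ContDiff ℝ n ψ)
    (hc : HasCompactSupport ψ) : ContDiff ℝ n (forwardAverage h ψ) := by
  rw [forwardAverage_eq_convolution]
  exact hc.contDiff_convolution_right _ (locallyIntegrable_comp_neg hh) hψ

theorem hasDerivAt_forwardAverage (hh : LocallyIntegrable h) (hψ : ContDiff ℝ 1 ψ)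
    (hc : HasCompactSupport ψ) (s : ℝ) :
    HasDerivAt (forwardAverage h ψ) (forwardAverage h (deriv ψ) s) s := by
  rw [forwardAverage_eq_convolution, forwardAverage_eq_convolution]
  exact hc.hasDerivAt_convolution_right _ (locallyIntegrable_comp_neg hh) hψ s

theorem hasCompactSupport_forwardAverage (hh : HasCompactSupport h)
    (hc : HasCompactSupport ψ) : HasCompactSupport (forwardAverage h ψ) := by
  rw [forwardAverage_eq_convolution]
  exact (hh.comp_homeomorph (Homeomorph.neg ℝ)).convolution _ hc

theorem forwardAverage_eq_zero (hh : ∀ q ≤ 0, h q = 0) (hb : ∀ t, b ≤ t → ψ t = 0)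
    {s : ℝ} (hs : b ≤ s) : forwardAverage h ψ s = 0 := by
  refine integral_eq_zero_of_ae (Eventually.of_forall fun q => ?_)
  rcases le_total q 0 with hq | hq
  · simp [hh q hq]
  · simp [hb (s + q) (by linarith)]

theorem forwardAverage_nonneg (hh : ∀ q, 0 ≤ h q) (hψ : ∀ t, 0 ≤ ψ t) (s : ℝ) :
    0 ≤ forwardAverage h ψ s :=
  integral_nonneg fun q => mul_nonneg (hh q) (hψ _)

theorem forwardAverage_sub (hh : LocallyIntegrable h) (hk : LocallyIntegrable k)
    (hψ : Continuous ψ) (hc : HasCompactSupport ψ) :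
    forwardAverage (h - k) ψ = forwardAverage h ψ - forwardAverage k ψ := by
  funext s
  simp only [forwardAverage, Pi.sub_apply, sub_mul]
  exact integral_sub (integrable_mul_comp_add hh hψ hc s) (integrable_mul_comp_add hk hψ hc s)

theorem forwardAverage_smul (L : ℝ) (h ψ : ℝ → ℝ) :
    forwardAverage (L • h) ψ = L • forwardAverage h ψ := by
  funext s
  simp only [forwardAverage, Pi.smul_apply, smul_eq_mul, mul_assoc, integral_const_mul]

theorem comp_neg_convolution_comp_neg (h k : ℝ → ℝ) :
    (fun t => h (-t)) ⋆ (fun t => k (-t)) = fun x => (h ⋆ k) (-x) := by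
  funext x
  rw [convolution_lsmul, convolution_lsmul, ← integral_neg_eq_self]
  simp only [neg_neg, sub_eq_add_neg, neg_add_rev, smul_eq_mul, add_comm]

theorem forwardAverage_convolution (hh : LocallyIntegrable h) (hk : LocallyIntegrable k)
    (hkc : HasCompactSupport k) (hhk : ConvolutionExists h k (ContinuousLinearMap.lsmul ℝ ℝ))
    (hψ : Continuous ψ) (hc : HasCompactSupport ψ) :
    forwardAverage (h ⋆ k) ψ = forwardAverage h (forwardAverage k ψ) := by
  have hh' := locallyIntegrable_comp_neg hh
  have hk' := locallyIntegrable_comp_neg hk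
  have hkc' : HasCompactSupport fun t => ‖k (-t)‖ :=
    (hkc.comp_homeomorph (Homeomorph.neg ℝ)).norm
  simp only [forwardAverage_eq_convolution, ← comp_neg_convolution_comp_neg]
  funext s
  refine convolution_assoc _ _ _ _ (by simp [mul_assoc]) hh'.aestronglyMeasurable
    hk'.aestronglyMeasurable hψ.aestronglyMeasurable (Eventually.of_forall fun x => ?_)
    (Eventually.of_forall (hc.norm.convolutionExists_right _ (fun x => (hk' x).norm) hψ.norm)) ?_
  · simpa [ConvolutionExistsAt, sub_eq_add_neg, add_comm] using (hhk (-x)).comp_neg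
  · exact (hkc'.convolution _ hc.norm).convolutionExists_right _ (fun x => (hh' x).norm)
      (hc.norm.continuous_convolution_right _ (fun x => (hk' x).norm) hψ.norm) s

theorem setIntegral_Ici_forwardAverage_deriv (hh : LocallyIntegrable h) (hh0 : ∀ q ≤ 0, h q = 0)
    (hψ : ContDiff ℝ 1 ψ) (hc : HasCompactSupport ψ) (hb : ∀ t, b ≤ t → ψ t = 0) (a : ℝ) :
    ∫ s in Ici a, forwardAverage h (deriv ψ) s = -forwardAverage h ψ a := by
  have hint : IntegrableOn (forwardAverage h (deriv ψ)) (Ici a) :=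
    integrableOn_Ici_of_eq_zero
      (continuous_forwardAverage hh (hψ.continuous_deriv le_rfl) hc.deriv).continuousOn
      fun t => forwardAverage_eq_zero hh0
        (deriv_eq_zero_of_eq_zero_of_ge (hψ.differentiable one_ne_zero) hb)
  have hlim : Tendsto (forwardAverage h ψ) atTop (𝓝 0) :=
    tendsto_const_nhds.congr' ((eventually_ge_atTop b).mono fun t ht =>
      (forwardAverage_eq_zero hh0 hb ht).symm)
  rw [integral_Ici_eq_integral_Ioi, integral_Ioi_of_hasDerivAt_of_tendsto'
    (fun t _ => hasDerivAt_forwardAverage hh hψ hc t)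
    (hint.mono_set Ioi_subset_Ici_self) hlim, zero_sub]

theorem forwardAverage_deriv_nonpos (hh : Monotone h) (hψ : ContDiff ℝ 1 ψ)
    (hc : HasCompactSupport ψ) (hψ0 : ∀ t, 0 ≤ ψ t) (s : ℝ) :
    forwardAverage h (deriv ψ) s ≤ 0 := by
  have hanti : Antitone (forwardAverage h ψ) := fun s s' hss => by
    have hsub (u : ℝ) : forwardAverage h ψ u = ∫ t, h (t - u) * ψ t := by
      rw [forwardAverage, ← integral_sub_right_eq_self _ u]
      simp only [add_sub_cancel]
    have hint (u : ℝ) : Integrable fun t => h (t - u) * ψ t := by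
      simpa using (integrable_mul_comp_add hh.locallyIntegrable hψ.continuous hc u).comp_sub_right u
    rw [hsub, hsub]
    exact integral_mono (hint s') (hint s) fun t =>
      mul_le_mul_of_nonneg_right (hh (by linarith)) (hψ0 t)
  rw [← (hasDerivAt_forwardAverage hh.locallyIntegrable hψ hc s).deriv]
  exact hanti.deriv_nonpos

theorem forwardAverage_le_mul_integral (hh : Monotone h) (hψ : Continuous ψ)
    (hc : HasCompactSupport ψ) (hψ0 : ∀ t, 0 ≤ ψ t) (hb : ∀ t, b ≤ t → ψ t = 0) (a : ℝ) :
    forwardAverage h ψ a ≤ h (b - a) * ∫ t, ψ t := by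
  rw [← integral_add_left_eq_self ψ a, ← integral_const_mul]
  refine integral_mono (integrable_mul_comp_add hh.locallyIntegrable hψ hc a)
    (((hψ.integrable_of_hasCompactSupport hc).comp_add_left a).const_mul _) fun q => ?_
  rcases le_or_gt b (a + q) with hq | hq
  · simp only [hb _ hq, mul_zero, le_refl]
  · exact mul_le_mul_of_nonneg_right (hh (by linarith)) (hψ0 _)

end ForwardAverage

section RiemannLiouville

/-- The Riemann–Liouville kernel `θ(x) x ^ (β - 1) / Γ(β)`, whose convolution with a function is its
fractional integral of order `β`. Its value at `0` is `0`, so that `rlKernel 1` is the indicator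
of `(0, ∞)`. -/
def rlKernel (β : ℝ) : ℝ → ℝ := (Ioi 0).indicator fun x => x ^ (β - 1) / Real.Gamma β

variable {β γ : ℝ} {x : ℝ}

theorem rlKernel_of_nonpos (β : ℝ) (hx : x ≤ 0) : rlKernel β x = 0 :=
  indicator_of_notMem (notMem_Ioi.2 hx) _

theorem rlKernel_of_pos (β : ℝ) (hx : 0 < x) : rlKernel β x = x ^ (β - 1) / Real.Gamma β :=
  indicator_of_mem (mem_Ioi.2 hx) _

theorem rlKernel_one_of_pos (hx : 0 < x) : rlKernel 1 x = 1 := by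
  rw [rlKernel_of_pos 1 hx, sub_self, Real.rpow_zero, Real.Gamma_one, div_one]

theorem rlKernel_pos (hβ : 0 < β) (hx : 0 < x) : 0 < rlKernel β x := by
  rw [rlKernel_of_pos β hx]
  exact div_pos (Real.rpow_pos_of_pos hx _) (Real.Gamma_pos_of_pos hβ)

theorem rlKernel_nonneg (hβ : 0 < β) (x : ℝ) : 0 ≤ rlKernel β x := by
  rcases le_or_gt x 0 with hx | hx
  · rw [rlKernel_of_nonpos β hx]
  · exact (rlKernel_pos hβ hx).le

theorem antitoneOn_rlKernel (hβ₀ : 0 < β) (hβ₁ : β ≤ 1) : AntitoneOn (rlKernel β) (Ioi 0) := by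
  intro x hx x' hx' hxx
  rw [rlKernel_of_pos β hx, rlKernel_of_pos β hx']
  exact div_le_div_of_nonneg_right (Real.rpow_le_rpow_of_nonpos hx hxx (by linarith))
    (Real.Gamma_pos_of_pos hβ₀).le

theorem monotone_rlKernel (hβ : 1 ≤ β) : Monotone (rlKernel β) := by
  intro x x' hxx
  rcases le_or_gt x 0 with hx | hx
  · rw [rlKernel_of_nonpos β hx]
    exact rlKernel_nonneg (by linarith) x'
  · rw [rlKernel_of_pos β hx, rlKernel_of_pos β (hx.trans_le hxx)]
    exact div_le_div_of_nonneg_right (Real.rpow_le_rpow hx.le hxx (by linarith))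
      (Real.Gamma_pos_of_pos (by linarith)).le

theorem tendsto_rlKernel_zero (hβ : 1 < β) : Tendsto (rlKernel β) (𝓝[>] 0) (𝓝 0) := by
  have hlim : Tendsto (fun x : ℝ => x ^ (β - 1) / Real.Gamma β) (𝓝 0) (𝓝 0) := by
    have h := (Real.continuousAt_rpow_const 0 (β - 1) (Or.inr (by linarith))).tendsto
    rw [Real.zero_rpow (by linarith)] at h
    simpa using h.div_const (Real.Gamma β)
  refine (hlim.mono_left nhdsWithin_le_nhds).congr' ?_
  filter_upwards [self_mem_nhdsWithin] with x hx using (rlKernel_of_pos β hx).symm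

theorem locallyIntegrable_rlKernel (hβ : 0 < β) : LocallyIntegrable (rlKernel β) := by
  intro x
  set R := max x 0 + 1
  have hR : 0 ≤ R := by positivity
  have hpow : IntegrableOn (fun x : ℝ => x ^ (β - 1) / Real.Gamma β) (Ioc 0 R) := by
    rw [← intervalIntegrable_iff_integrableOn_Ioc_of_le hR]
    exact (intervalIntegral.intervalIntegrable_rpow' (by linarith)).div_const _
  refine ⟨Iic R, Iic_mem_nhds (by grind), ?_⟩
  rwa [rlKernel, IntegrableOn, integrable_indicator_iff measurableSet_Ioi, IntegrableOn,
    Measure.restrict_restrict measurableSet_Ioi, Ioi_inter_Iic]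

theorem integral_rpow_mul_sub_rpow (hβ : 0 < β) (hγ : 0 < γ) (hx : 0 < x) :
    ∫ t in 0..x, t ^ (β - 1) * (x - t) ^ (γ - 1)
      = x ^ (β + γ - 1) * (Real.Gamma β * Real.Gamma γ / Real.Gamma (β + γ)) := by
  have hbeta : Complex.betaIntegral β γ
      = ((Real.Gamma β * Real.Gamma γ / Real.Gamma (β + γ) : ℝ) : ℂ) := by
    have hne : (Real.Gamma (β + γ) : ℂ) ≠ 0 :=
      Complex.ofReal_ne_zero.2 (Real.Gamma_pos_of_pos (by positivity)).ne'
    have h := Complex.Gamma_mul_Gamma_eq_betaIntegral (s := β) (t := γ) (by simpa) (by simpa)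
    rw [← Complex.ofReal_add, Complex.Gamma_ofReal, Complex.Gamma_ofReal,
      Complex.Gamma_ofReal] at h
    push_cast
    rw [h, mul_div_cancel_left₀ _ hne]
  have hscaled := Complex.betaIntegral_scaled (β : ℂ) (γ : ℂ) hx
  rw [hbeta] at hscaled
  rw [← Complex.ofReal_inj, ← intervalIntegral.integral_ofReal, Complex.ofReal_mul,
    Complex.ofReal_cpow hx.le]
  push_cast at hscaled ⊢
  rw [← hscaled]
  refine intervalIntegral.integral_congr fun t ht => ?_
  rw [uIcc_of_le hx.le] at ht
  simp only [Complex.ofReal_cpow ht.1,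
    Complex.ofReal_cpow (sub_nonneg.2 ht.2)]
  push_cast
  rfl

theorem rlKernel_mul_rlKernel_sub (β γ x t : ℝ) :
    rlKernel β t * rlKernel γ (x - t) = (Ioo 0 x).indicator
      (fun t => t ^ (β - 1) * (x - t) ^ (γ - 1) / (Real.Gamma β * Real.Gamma γ)) t := by
  by_cases ht : t ∈ Ioo 0 x
  · rw [indicator_of_mem ht, rlKernel_of_pos β ht.1, rlKernel_of_pos γ (sub_pos.2 ht.2),
      div_mul_div_comm]
  · rw [indicator_of_notMem ht]
    rcases le_or_gt t 0 with ht0 | ht0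
    · rw [rlKernel_of_nonpos β ht0, zero_mul]
    · have hxt : x ≤ t := not_lt.1 fun htx => ht ⟨ht0, htx⟩
      rw [rlKernel_of_nonpos γ (sub_nonpos.2 hxt), mul_zero]

theorem integral_rlKernel_mul_rlKernel (hβ : 0 < β) (hγ : 0 < γ) (x : ℝ) :
    ∫ t, rlKernel β t * rlKernel γ (x - t) = rlKernel (β + γ) x := by
  simp only [rlKernel_mul_rlKernel_sub]
  rw [integral_indicator measurableSet_Ioo, integral_div]
  rcases le_or_gt x 0 with hx | hx
  · rw [Ioo_eq_empty_of_le hx, setIntegral_empty, zero_div, rlKernel_of_nonpos _ hx]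
  · have hβ' := (Real.Gamma_pos_of_pos hβ).ne'
    have hγ' := (Real.Gamma_pos_of_pos hγ).ne'
    rw [← integral_Ioc_eq_integral_Ioo, ← intervalIntegral.integral_of_le hx.le,
      integral_rpow_mul_sub_rpow hβ hγ hx, rlKernel_of_pos _ hx]
    field_simp

theorem convolutionExists_rlKernel (hβ : 0 < β) (hγ : 0 < γ) :
    ConvolutionExists (rlKernel β) (rlKernel γ) (ContinuousLinearMap.lsmul ℝ ℝ) := by
  intro x
  rcases le_or_gt x 0 with hx | hx
  · refine (integrable_zero ℝ ℝ volume).congr (Eventually.of_forall fun t => ?_)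
    simpa [Ioo_eq_empty_of_le hx] using (rlKernel_mul_rlKernel_sub β γ x t).symm
  · refine Integrable.of_integral_ne_zero ?_
    exact (integral_rlKernel_mul_rlKernel hβ hγ x).trans_ne
      (rlKernel_pos (by positivity) hx).ne'

theorem forwardAverage_rlKernel_one_deriv {φ : ℝ → ℝ} (hφ : ContDiff ℝ 1 φ)
    (hc : HasCompactSupport φ) : forwardAverage (rlKernel 1) (deriv φ) = -φ := by
  funext s
  have hind (q : ℝ) : rlKernel 1 q * deriv φ (s + q)
      = (Ioi 0).indicator (deriv fun q => φ (s + q)) q := by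
    rcases le_or_gt q 0 with hq | hq
    · rw [rlKernel_of_nonpos 1 hq, zero_mul, indicator_of_notMem (notMem_Ioi.2 hq)]
    · rw [rlKernel_one_of_pos hq, one_mul, indicator_of_mem (mem_Ioi.2 hq),
        deriv_comp_const_add]
  simp only [forwardAverage, hind]
  have hcs : HasCompactSupport fun q => φ (s + q) := hc.comp_homeomorph (Homeomorph.addLeft s)
  rw [integral_indicator measurableSet_Ioi, hcs.integral_Ioi_deriv_eq (by fun_prop), add_zero,
    Pi.neg_apply]

end RiemannLiouville

section Resolvent

/-- The amount by which the convolution `k ⋆ r` falls short of the Heaviside function. It vanishes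
when `(k, r)` is a Sonine pair, such as `rlKernel (1 - α)` and `rlKernel α`. -/
def sonineDefect (k r : ℝ → ℝ) : ℝ → ℝ := rlKernel 1 - k ⋆ r

/-- A nonnegative compactly supported kernel `r` is a subresolvent of `k` at rate `L` if both the
Sonine defect of `(k, r)` and the defect `θ - (k + L θ) ⋆ r` in the resolvent equation are monotone.
For `k = rlKernel (1 - α)` it plays the role of the resolvent of the fractional operator `D^α + L`,
for which the second defect vanishes. -/
structure IsSubresolvent (k : ℝ → ℝ) (L : ℝ) (r : ℝ → ℝ) : Prop where
  locallyIntegrable : LocallyIntegrable r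
  hasCompactSupport : HasCompactSupport r
  nonneg : ∀ x, 0 ≤ r x
  eq_zero_of_nonpos : ∀ x ≤ 0, r x = 0
  convolutionExists : ConvolutionExists k r (ContinuousLinearMap.lsmul ℝ ℝ)
  convolutionExists_one : ConvolutionExists (rlKernel 1) r (ContinuousLinearMap.lsmul ℝ ℝ)
  convolution_pos : ∀ x, 0 < x → 0 < (k ⋆ r) x
  tendsto_sonineDefect : Tendsto (sonineDefect k r) (𝓝[>] 0) (𝓝 0)
  monotone_sonineDefect : Monotone (sonineDefect k r)
  monotone_sonineDefect_sub : Monotone (sonineDefect k r - L • (rlKernel 1 ⋆ r))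

variable {k r ρ : ℝ → ℝ} {α β δ L x : ℝ}

theorem sonineDefect_of_nonpos (hk : ∀ x ≤ 0, k x = 0) (hr : ∀ x ≤ 0, r x = 0) (hx : x ≤ 0) :
    sonineDefect k r x = 0 := by
  rw [sonineDefect, Pi.sub_apply, rlKernel_of_nonpos 1 hx, zero_sub, neg_eq_zero]
  refine integral_eq_zero_of_ae (Eventually.of_forall fun t => ?_)
  rcases le_total t 0 with ht | ht
  · simp [hk t ht]
  · simp [hr (x - t) (by linarith)]

theorem sonineDefect_lt_one (hx : 0 < x) (h : 0 < (k ⋆ r) x) : sonineDefect k r x < 1 := by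
  rw [sonineDefect, Pi.sub_apply, rlKernel_one_of_pos hx]
  linarith

theorem mul_indicator_Iio_sub (hk : ∀ x ≤ 0, k x = 0) (hx : x ≤ δ) (t : ℝ) :
    k t * (Iio δ).indicator ρ (x - t) = k t * ρ (x - t) := by
  rcases le_or_gt t 0 with ht | ht
  · rw [hk t ht, zero_mul, zero_mul]
  · rw [indicator_of_mem (mem_Iio.2 (by linarith))]

theorem convolution_pos_of_pos (hk : ∀ x, 0 ≤ k x) (hkpos : ∀ x, 0 < x → 0 < k x)
    (hr : ∀ x, 0 ≤ r x) (hδ : 0 < δ) (hrpos : ∀ x ∈ Ioo 0 δ, 0 < r x) (hx : 0 < x)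
    (h : ConvolutionExistsAt k r x (ContinuousLinearMap.lsmul ℝ ℝ)) : 0 < (k ⋆ r) x := by
  have hnn (t : ℝ) : 0 ≤ k t • r (x - t) := mul_nonneg (hk t) (hr _)
  refine (integral_pos_iff_support_of_nonneg hnn h).2 (lt_of_lt_of_le ?_ (measure_mono
    (s := Ioo (max 0 (x - δ)) x) fun t ht => ?_))
  · rw [Real.volume_Ioo, ENNReal.ofReal_pos, sub_pos]
    exact max_lt hx (by linarith)
  · obtain ⟨h0, hδt⟩ := max_lt_iff.1 ht.1
    exact (mul_pos (hkpos t h0) (hrpos _ ⟨sub_pos.2 ht.2, by linarith⟩)).ne'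

theorem sub_mul_le_sub_mul (hk : AntitoneOn k (Ioi 0)) (hr : ∀ x, 0 ≤ r x)
    (hrδ : ∀ x, δ ≤ x → r x = 0) {x' : ℝ} (hx : δ ≤ x) (hxx : x ≤ x') (t : ℝ) :
    k (x' - t) * r t ≤ k (x - t) * r t := by
  rcases le_or_gt δ t with ht | ht
  · rw [hrδ t ht, mul_zero, mul_zero]
  · exact mul_le_mul_of_nonneg_right (hk (mem_Ioi.2 (by linarith)) (mem_Ioi.2 (by linarith))
      (by linarith)) (hr t)

theorem convolutionExistsAt_of_antitoneOn (hk : AntitoneOn k (Ioi 0)) (hk0 : ∀ x, 0 ≤ k x)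
    (hkm : AEStronglyMeasurable k) (hrm : AEStronglyMeasurable r)
    (hr : ∀ x, 0 ≤ r x) (hrδ : ∀ x, δ ≤ x → r x = 0) (hx : δ ≤ x)
    (h : ConvolutionExistsAt k r δ (ContinuousLinearMap.lsmul ℝ ℝ)) :
    ConvolutionExistsAt k r x (ContinuousLinearMap.lsmul ℝ ℝ) := by
  rw [convolutionExistsAt_iff_integrable_swap] at h ⊢
  refine h.mono (hkm.convolution_integrand_swap_snd (ContinuousLinearMap.lsmul ℝ ℝ) hrm x)
    (Eventually.of_forall fun t => ?_)
  have hnn (x : ℝ) : 0 ≤ k (x - t) * r t := mul_nonneg (hk0 _) (hr t)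
  simp only [ContinuousLinearMap.lsmul_apply, smul_eq_mul, Real.norm_of_nonneg (hnn _)]
  exact sub_mul_le_sub_mul hk hr hrδ le_rfl hx t

theorem antitoneOn_convolution (hk : AntitoneOn k (Ioi 0)) (hr : ∀ x, 0 ≤ r x)
    (hrδ : ∀ x, δ ≤ x → r x = 0)
    (h : ConvolutionExists k r (ContinuousLinearMap.lsmul ℝ ℝ)) :
    AntitoneOn (k ⋆ r) (Ici δ) := by
  intro x hx x' _ hxx
  rw [convolution_lsmul_swap, convolution_lsmul_swap]
  exact integral_mono (h x').integrable_swap (h x).integrable_swap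
    (sub_mul_le_sub_mul hk hr hrδ hx hxx)

/-- The first two terms `x ^ (α - 1) / Γ(α) - L x ^ (2 α - 1) / Γ(2 α)` of the Mittag-Leffler
resolvent of `D^α + L`. -/
def resolventHead (α L : ℝ) : ℝ → ℝ := rlKernel α - L • rlKernel (2 * α)

/-- The function `resolventHead α L`, cut off at `δ`. -/
def truncatedResolvent (α L δ : ℝ) : ℝ → ℝ := (Iio δ).indicator (resolventHead α L)

theorem exists_resolventHead_pos (hα : 0 < α) (L : ℝ) :
    ∃ δ > 0, ∀ x ∈ Ioo 0 δ, 0 < resolventHead α L x := by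
  have hΓ := Real.Gamma_pos_of_pos hα
  have hlim : Tendsto (fun x : ℝ => L * x ^ α / Real.Gamma (2 * α)) (𝓝 0) (𝓝 0) := by
    have h := (Real.continuousAt_rpow_const 0 α (Or.inr hα.le)).tendsto
    rw [Real.zero_rpow hα.ne'] at h
    simpa using (h.const_mul L).div_const (Real.Gamma (2 * α))
  obtain ⟨δ, hδ, hball⟩ := Metric.eventually_nhds_iff.1
    (hlim.eventually_lt_const (inv_pos.2 hΓ))
  refine ⟨δ, hδ, fun x hx => ?_⟩
  have hsmall : L * x ^ α / Real.Gamma (2 * α) < (Real.Gamma α)⁻¹ :=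
    hball (by simpa [abs_of_pos hx.1] using hx.2)
  have hfactor : resolventHead α L x
      = x ^ (α - 1) * ((Real.Gamma α)⁻¹ - L * x ^ α / Real.Gamma (2 * α)) := by
    have hpow : x ^ (2 * α - 1) = x ^ (α - 1) * x ^ α := by
      rw [← Real.rpow_add hx.1]; ring_nf
    rw [resolventHead, Pi.sub_apply, Pi.smul_apply, smul_eq_mul, rlKernel_of_pos _ hx.1,
      rlKernel_of_pos _ hx.1, hpow]
    ring
  rw [hfactor]
  exact mul_pos (Real.rpow_pos_of_pos hx.1 _) (sub_pos.2 hsmall)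

theorem locallyIntegrable_truncatedResolvent (hα : 0 < α) (L δ : ℝ) :
    LocallyIntegrable (truncatedResolvent α L δ) :=
  ((locallyIntegrable_rlKernel hα).sub
    ((locallyIntegrable_rlKernel (by positivity)).smul L)).indicator measurableSet_Iio

theorem truncatedResolvent_eq_zero_of_ge (α L : ℝ) (hx : δ ≤ x) : truncatedResolvent α L δ x = 0 :=
  indicator_of_notMem (notMem_Iio.2 hx) _

theorem truncatedResolvent_eq_zero_of_nonpos (α L δ : ℝ) (hx : x ≤ 0) :
    truncatedResolvent α L δ x = 0 := by
  refine indicator_apply_eq_zero.2 fun _ => ?_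
  simp only [resolventHead, Pi.sub_apply, Pi.smul_apply, rlKernel_of_nonpos _ hx, smul_zero,
    sub_zero]

theorem truncatedResolvent_pos (hpos : ∀ x ∈ Ioo 0 δ, 0 < resolventHead α L x)
    (hx : x ∈ Ioo 0 δ) : 0 < truncatedResolvent α L δ x := by
  rw [truncatedResolvent, indicator_of_mem (mem_Iio.2 hx.2)]
  exact hpos x hx

theorem truncatedResolvent_nonneg (hpos : ∀ x ∈ Ioo 0 δ, 0 < resolventHead α L x) (x : ℝ) :
    0 ≤ truncatedResolvent α L δ x := by
  rcases le_or_gt x 0 with hx | hx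
  · rw [truncatedResolvent_eq_zero_of_nonpos α L δ hx]
  · rcases le_or_gt δ x with hδ | hδ
    · rw [truncatedResolvent_eq_zero_of_ge α L hδ]
    · exact (truncatedResolvent_pos hpos ⟨hx, hδ⟩).le

theorem convolutionExists_rlKernel_resolventHead (hβ : 0 < β) (hα : 0 < α) (L : ℝ) :
    ConvolutionExists (rlKernel β) (resolventHead α L) (ContinuousLinearMap.lsmul ℝ ℝ) := by
  intro x
  have h₁ := convolutionExists_rlKernel hβ hα x
  have h₂ := convolutionExists_rlKernel hβ (show 0 < 2 * α by positivity) x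
  refine (h₁.integrable.sub (h₂.integrable.const_mul L)).congr (Eventually.of_forall fun t => ?_)
  simp only [resolventHead, Pi.sub_apply, Pi.smul_apply, ContinuousLinearMap.lsmul_apply,
    smul_eq_mul]
  ring

theorem convolutionExists_rlKernel_truncatedResolvent (hβ₀ : 0 < β) (hβ₁ : β ≤ 1) (hα : 0 < α)
    (hpos : ∀ x ∈ Ioo 0 δ, 0 < resolventHead α L x) :
    ConvolutionExists (rlKernel β) (truncatedResolvent α L δ)
      (ContinuousLinearMap.lsmul ℝ ℝ) := by
  have hle (x : ℝ) (hx : x ≤ δ) : ConvolutionExistsAt (rlKernel β) (truncatedResolvent α L δ) x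
      (ContinuousLinearMap.lsmul ℝ ℝ) :=
    (convolutionExists_rlKernel_resolventHead hβ₀ hα L x).congr (Eventually.of_forall fun t =>
      (mul_indicator_Iio_sub (fun _ => rlKernel_of_nonpos β) hx t).symm)
  intro x
  rcases le_total x δ with hx | hx
  · exact hle x hx
  · exact convolutionExistsAt_of_antitoneOn (antitoneOn_rlKernel hβ₀ hβ₁) (rlKernel_nonneg hβ₀)
      (locallyIntegrable_rlKernel hβ₀).aestronglyMeasurable
      (locallyIntegrable_truncatedResolvent hα L δ).aestronglyMeasurable
      (truncatedResolvent_nonneg hpos) (fun _ => truncatedResolvent_eq_zero_of_ge α L) hx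
      (hle δ le_rfl)

theorem rlKernel_convolution_truncatedResolvent (hβ : 0 < β) (hα : 0 < α) (hx : x ≤ δ) :
    (rlKernel β ⋆ truncatedResolvent α L δ) x
      = rlKernel (β + α) x - L * rlKernel (β + 2 * α) x := by
  have hα₂ : 0 < 2 * α := by positivity
  have h₁ : Integrable fun t => rlKernel β t * rlKernel α (x - t) :=
    convolutionExists_rlKernel hβ hα x
  have h₂ : Integrable fun t => rlKernel β t * rlKernel (2 * α) (x - t) :=
    convolutionExists_rlKernel hβ hα₂ x
  rw [← integral_rlKernel_mul_rlKernel hβ hα x, ← integral_rlKernel_mul_rlKernel hβ hα₂ x,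
    ← integral_const_mul, ← integral_sub h₁ (h₂.const_mul L), convolution_lsmul]
  refine integral_congr_ae (Eventually.of_forall fun t => ?_)
  simp only [smul_eq_mul]
  rw [truncatedResolvent, mul_indicator_Iio_sub (fun _ => rlKernel_of_nonpos β) hx, resolventHead,
    Pi.sub_apply, Pi.smul_apply, smul_eq_mul]
  ring

theorem antitoneOn_rlKernel_convolution_truncatedResolvent (hβ₀ : 0 < β) (hβ₁ : β ≤ 1)
    (hα : 0 < α) (hpos : ∀ x ∈ Ioo 0 δ, 0 < resolventHead α L x) :
    AntitoneOn (rlKernel β ⋆ truncatedResolvent α L δ) (Ici δ) :=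
  antitoneOn_convolution (antitoneOn_rlKernel hβ₀ hβ₁) (truncatedResolvent_nonneg hpos)
    (fun _ => truncatedResolvent_eq_zero_of_ge α L)
    (convolutionExists_rlKernel_truncatedResolvent hβ₀ hβ₁ hα hpos)

theorem sonineDefect_truncatedResolvent (hα₀ : 0 < α) (hα₁ : α < 1) (hx : x ≤ δ) :
    sonineDefect (rlKernel (1 - α)) (truncatedResolvent α L δ) x = L * rlKernel (1 + α) x := by
  rw [sonineDefect, Pi.sub_apply,
    rlKernel_convolution_truncatedResolvent (sub_pos.2 hα₁) hα₀ hx]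
  ring_nf

theorem sonineDefect_sub_truncatedResolvent (hα₀ : 0 < α) (hα₁ : α < 1) (hx : x ≤ δ) :
    (sonineDefect (rlKernel (1 - α)) (truncatedResolvent α L δ)
      - L • (rlKernel 1 ⋆ truncatedResolvent α L δ)) x = L ^ 2 * rlKernel (1 + 2 * α) x := by
  rw [Pi.sub_apply, sonineDefect_truncatedResolvent hα₀ hα₁ hx, Pi.smul_apply, smul_eq_mul,
    rlKernel_convolution_truncatedResolvent one_pos hα₀ hx]
  ring

theorem monotoneOn_sonineDefect_truncatedResolvent (hα₀ : 0 < α) (hα₁ : α < 1)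
    (hpos : ∀ x ∈ Ioo 0 δ, 0 < resolventHead α L x) :
    MonotoneOn (sonineDefect (rlKernel (1 - α)) (truncatedResolvent α L δ)) (Ici δ) := by
  rw [sonineDefect, sub_eq_add_neg]
  exact ((monotone_rlKernel le_rfl).monotoneOn _).add
    (antitoneOn_rlKernel_convolution_truncatedResolvent (sub_pos.2 hα₁)
      (sub_le_self 1 hα₀.le) hα₀ hpos).neg

theorem monotone_sonineDefect_truncatedResolvent (hα₀ : 0 < α) (hα₁ : α < 1) (hL : 0 ≤ L)
    (hpos : ∀ x ∈ Ioo 0 δ, 0 < resolventHead α L x) :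
    Monotone (sonineDefect (rlKernel (1 - α)) (truncatedResolvent α L δ)) :=
  MonotoneOn.Iic_union_Ici
    ((((monotone_rlKernel (by linarith)).const_mul hL).monotoneOn (Iic δ)).congr fun x hx =>
      (sonineDefect_truncatedResolvent hα₀ hα₁ hx).symm)
    (monotoneOn_sonineDefect_truncatedResolvent hα₀ hα₁ hpos)

theorem monotone_sonineDefect_sub_truncatedResolvent (hα₀ : 0 < α) (hα₁ : α < 1) (hL : 0 ≤ L)
    (hpos : ∀ x ∈ Ioo 0 δ, 0 < resolventHead α L x) :
    Monotone (sonineDefect (rlKernel (1 - α)) (truncatedResolvent α L δ)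
      - L • (rlKernel 1 ⋆ truncatedResolvent α L δ)) := by
  refine MonotoneOn.Iic_union_Ici
    ((((monotone_rlKernel (by linarith)).const_mul (sq_nonneg L)).monotoneOn (Iic δ)).congr
      fun x hx => (sonineDefect_sub_truncatedResolvent hα₀ hα₁ hx).symm) ?_
  rw [sub_eq_add_neg]
  refine (monotoneOn_sonineDefect_truncatedResolvent hα₀ hα₁ hpos).add (AntitoneOn.neg ?_)
  exact fun x hx x' hx' hxx => mul_le_mul_of_nonneg_left
    (antitoneOn_rlKernel_convolution_truncatedResolvent one_pos le_rfl hα₀ hpos hx hx' hxx) hL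

theorem exists_isSubresolvent_rlKernel (hα₀ : 0 < α) (hα₁ : α < 1) (hL : 0 ≤ L) :
    ∃ r, IsSubresolvent (rlKernel (1 - α)) L r := by
  obtain ⟨δ, hδ, hpos⟩ := exists_resolventHead_pos hα₀ L
  have hβ : 0 < 1 - α := sub_pos.2 hα₁
  have hexists := convolutionExists_rlKernel_truncatedResolvent hβ (sub_le_self 1 hα₀.le) hα₀ hpos
  have hnn := truncatedResolvent_nonneg hpos
  refine ⟨truncatedResolvent α L δ,
    { locallyIntegrable := locallyIntegrable_truncatedResolvent hα₀ L δ
      hasCompactSupport := HasCompactSupport.intro (isCompact_Icc (a := 0) (b := δ)) fun x hx => ?_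
      nonneg := hnn
      eq_zero_of_nonpos := fun x => truncatedResolvent_eq_zero_of_nonpos α L δ
      convolutionExists := hexists
      convolutionExists_one :=
        convolutionExists_rlKernel_truncatedResolvent one_pos le_rfl hα₀ hpos
      convolution_pos := fun x hx => convolution_pos_of_pos (rlKernel_nonneg hβ)
        (fun _ => rlKernel_pos hβ) hnn hδ (fun _ => truncatedResolvent_pos hpos) hx (hexists x)
      tendsto_sonineDefect := ?_
      monotone_sonineDefect := monotone_sonineDefect_truncatedResolvent hα₀ hα₁ hL hpos
      monotone_sonineDefect_sub :=
        monotone_sonineDefect_sub_truncatedResolvent hα₀ hα₁ hL hpos }⟩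
  · rcases le_or_gt 0 x with h0 | h0
    · exact truncatedResolvent_eq_zero_of_ge α L (not_le.1 fun h => hx ⟨h0, h⟩).le
    · exact truncatedResolvent_eq_zero_of_nonpos α L δ h0.le
  · have hlim := (tendsto_rlKernel_zero (β := 1 + α) (by linarith)).const_mul L
    rw [mul_zero] at hlim
    refine hlim.congr' ?_
    filter_upwards [Ioo_mem_nhdsGT hδ] with x hx using
      (sonineDefect_truncatedResolvent hα₀ hα₁ hx.2.le).symm

end Resolvent

section Caputo

variable {α : ℝ} {T : EReal}

theorem Gamma_inv_mul_heavisidePow_eq_rlKernel (hα : α ≠ 0) (x : ℝ) :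
    (Real.Gamma (1 + -α))⁻¹ * heavisidePow (-α) x = rlKernel (1 - α) x := by
  have hexp : 1 - α - 1 = -α := by ring
  rcases lt_trichotomy x 0 with hx | rfl | hx
  · rw [rlKernel_of_nonpos _ hx.le, heavisidePow, if_neg (not_le.2 hx), mul_zero]
  · rw [rlKernel_of_nonpos _ le_rfl, heavisidePow, if_pos le_rfl,
      Real.zero_rpow (neg_ne_zero.2 hα), mul_zero]
  · rw [rlKernel_of_pos _ hx, heavisidePow, if_pos hx.le, hexp, ← sub_eq_add_neg, div_eq_inv_mul]

theorem locallyIntegrable_heavisidePow (hα₀ : α ≠ 0) (hα₁ : α < 1) :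
    LocallyIntegrable (heavisidePow (-α)) := by
  have hΓ : Real.Gamma (1 + -α) ≠ 0 := (Real.Gamma_pos_of_pos (by linarith)).ne'
  convert (locallyIntegrable_rlKernel (sub_pos.2 hα₁)).smul (Real.Gamma (1 + -α)) using 1
  funext x
  rw [Pi.smul_apply, smul_eq_mul, ← Gamma_inv_mul_heavisidePow_eq_rlKernel hα₀,
    mul_inv_cancel_left₀ hΓ]

theorem lineDeriv_testFunction_apply (φ : 𝓓((⊤ : Opens ℝ), ℝ)) (x : ℝ) :
    (∂_{(1 : ℝ)} φ) x = deriv φ x := by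
  change (TestFunction.lineDerivCLM ℝ (1 : ℝ) φ : 𝓓((⊤ : Opens ℝ), ℝ)) x = _
  rw [TestFunction.lineDerivCLM_apply_of_le (by simp), lineDeriv]
  simpa using deriv_comp_const_add (f := φ) x 0

theorem abelDistribution_apply (hα₀ : α ≠ 0) (hα₁ : α < 1) (φ : 𝓓((⊤ : Opens ℝ), ℝ)) :
    abelDistribution (-α) φ = -∫ x, rlKernel (1 - α) x * deriv φ x := by
  have hunfold : abelDistribution (-α) φ = (Real.Gamma (1 + -α))⁻¹ *
      TestFunction.integralAgainstBilinCLM (ContinuousLinearMap.mul ℝ ℝ) volume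
        (heavisidePow (-α)) (-∂_{(1 : ℝ)} φ) := by
    rw [abelDistribution]
    change _ * (∂_{(1 : ℝ)} (regularDistribution (heavisidePow (-α)))) φ = _
    rw [Distribution.lineDerivOp_apply_apply]
    rfl
  rw [hunfold, TestFunction.integralAgainstBilinCLM_eq_integral
    ((locallyIntegrable_heavisidePow hα₀ hα₁).locallyIntegrableOn _), ← integral_const_mul,
    ← integral_neg]
  refine integral_congr_ae (Eventually.of_forall fun x => ?_)
  have hneg : (-∂_{(1 : ℝ)} φ) x = -deriv φ x := congrArg Neg.neg (lineDeriv_testFunction_apply φ x)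
  simp only [ContinuousLinearMap.mul_apply', hneg,
    ← Gamma_inv_mul_heavisidePow_eq_rlKernel hα₀ x]
  ring

theorem caputo_eq_setIntegral (hα₀ : α ≠ 0) (hα₁ : α < 1) (u₀ : ℝ) (u : ℝ → ℝ)
    (φ : 𝓓(past T, ℝ)) :
    caputo α u₀ u φ
      = ∫ s in Ici 0, (u s - u₀) * -forwardAverage (rlKernel (1 - α)) (deriv φ) s := by
  have htranslate (s q : ℝ) : deriv (translate φ s) q = deriv φ (s + q) := by
    rw [add_comm s, ← deriv_comp_add_const]
    rfl
  simp only [caputo, convolve, abelDistribution_apply hα₀ hα₁, htranslate, forwardAverage]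

end Caputo

/-- Smooth nonnegative functions with compact support that vanish outside `(a, b)`. -/
structure IsBump (a b : ℝ) (ψ : ℝ → ℝ) : Prop where
  contDiff : ContDiff ℝ ∞ ψ
  hasCompactSupport : HasCompactSupport ψ
  nonneg : ∀ t, 0 ≤ ψ t
  eq_zero_of_le : ∀ t ≤ a, ψ t = 0
  eq_zero_of_ge : ∀ t, b ≤ t → ψ t = 0

section Bump

variable {a b C : ℝ} {ψ v w : ℝ → ℝ}

theorem IsBump.mono {a' b' : ℝ} (hψ : IsBump a b ψ) (ha : a' ≤ a) (hb : b ≤ b') :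
    IsBump a' b' ψ :=
  ⟨hψ.contDiff, hψ.hasCompactSupport, hψ.nonneg, fun t ht => hψ.eq_zero_of_le t (ht.trans ha),
    fun t ht => hψ.eq_zero_of_ge t (hb.trans ht)⟩

theorem IsBump.integrable (hψ : IsBump a b ψ) : Integrable ψ :=
  hψ.contDiff.continuous.integrable_of_hasCompactSupport hψ.hasCompactSupport

theorem IsBump.setIntegral_Ici (hψ : IsBump a b ψ) : ∫ t in Ici a, ψ t = ∫ t, ψ t :=
  setIntegral_eq_integral_of_forall_compl_eq_zero fun t ht =>
    hψ.eq_zero_of_le t (le_of_not_ge ht)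

theorem exists_isBump_ball {t ε : ℝ} (hε : 0 < ε) :
    ∃ ψ, IsBump (t - ε) (t + ε) ψ ∧ 0 < ∫ s, ψ s := by
  let β : ContDiffBump t := ⟨ε / 2, ε, by positivity, by linarith⟩
  have hzero (s : ℝ) (hs : ε ≤ |s - t|) : β s = 0 := β.zero_of_le_dist hs
  exact ⟨β, ⟨β.contDiff, β.hasCompactSupport, fun _ => β.nonneg,
    fun s hs => hzero s (by rw [abs_of_nonpos] <;> linarith),
    fun s hs => hzero s (by rw [abs_of_nonneg] <;> linarith)⟩, β.integral_pos⟩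

theorem integrableOn_Ici_mul {g : ℝ → ℝ} (hv : ContinuousOn v (Icc a b)) (hg : Continuous g)
    (hb : ∀ t, b ≤ t → g t = 0) : IntegrableOn (fun s => v s * g s) (Ici a) :=
  integrableOn_Ici_of_eq_zero (hv.mul hg.continuousOn) fun t ht => by rw [hb t ht, mul_zero]

theorem le_of_setIntegral_mul_isBump_le (ha : 0 ≤ a) (hab : a < b)
    (hw : ContinuousOn w (Icc 0 b))
    (h : ∀ ψ, IsBump a b ψ → ∫ s in Ici 0, w s * ψ s ≤ C * ∫ t, ψ t) :
    ∀ t ∈ Icc a b, w t ≤ C := by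
  have hIoo : ∀ t ∈ Ioo a b, w t ≤ C := by
    intro t ht
    by_contra! hlt
    obtain ⟨C', hC, hC'⟩ := exists_between hlt
    have hIcc : Icc 0 b ∈ 𝓝 t := Icc_mem_nhds (ha.trans_lt ht.1) ht.2
    obtain ⟨ε, hε, hball⟩ := Metric.nhds_basis_closedBall.eventually_iff.1
      (((hw.continuousAt hIcc).eventually_const_lt hC').and (Ioo_mem_nhds ht.1 ht.2))
    simp only [Real.closedBall_eq_Icc] at hball
    obtain ⟨ψ, hψ, hψpos⟩ := exists_isBump_ball (t := t) hε
    have haε : a ≤ t - ε := (hball ⟨le_rfl, by linarith⟩).2.1.le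
    have hψ' : IsBump a b ψ := hψ.mono haε (hball ⟨by linarith, le_rfl⟩).2.2.le
    have hle : ∫ s in Ici 0, C' * ψ s ≤ ∫ s in Ici 0, w s * ψ s := by
      refine integral_mono (hψ.integrable.const_mul C').integrableOn
        (integrableOn_Ici_mul hw hψ.contDiff.continuous hψ'.eq_zero_of_ge) fun s => ?_
      rcases le_total s (t - ε) with hs | hs
      · simp only [hψ.eq_zero_of_le s hs, mul_zero, le_refl]
      rcases le_total (t + ε) s with hs' | hs'
      · simp only [hψ.eq_zero_of_ge s hs', mul_zero, le_refl]
      · exact mul_le_mul_of_nonneg_right (hball ⟨hs, hs'⟩).1.le (hψ.nonneg s)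
    rw [integral_const_mul, (hψ'.mono ha le_rfl).setIntegral_Ici] at hle
    exact hC.not_ge (le_of_mul_le_mul_right (hle.trans (h ψ hψ')) hψpos)
  rw [← closure_Ioo hab.ne]
  refine le_on_closure hIoo ?_ continuousOn_const
  rw [closure_Ioo hab.ne]
  exact hw.mono (Icc_subset_Icc_left ha)

end Bump

section BumpAverage

variable {Q v ψ : ℝ → ℝ} {a b c : ℝ}

namespace IsBump

theorem contDiff_one (hψ : IsBump a b ψ) : ContDiff ℝ 1 ψ :=
  hψ.contDiff.of_le (by simp)

theorem continuous_forwardAverage_deriv (hψ : IsBump a b ψ) (hQ : Monotone Q) :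
    Continuous (forwardAverage Q (deriv ψ)) :=
  continuous_forwardAverage hQ.locallyIntegrable (hψ.contDiff_one.continuous_deriv le_rfl)
    hψ.hasCompactSupport.deriv

theorem forwardAverage_deriv_eq_zero (hψ : IsBump a b ψ) (hQ0 : ∀ x ≤ 0, Q x = 0) (t : ℝ)
    (ht : b ≤ t) : forwardAverage Q (deriv ψ) t = 0 :=
  forwardAverage_eq_zero hQ0 (deriv_eq_zero_of_eq_zero_of_ge
    (hψ.contDiff_one.differentiable one_ne_zero) hψ.eq_zero_of_ge) ht

theorem integrableOn_mul_neg_forwardAverage_deriv (hψ : IsBump a b ψ) (hQ : Monotone Q)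
    (hQ0 : ∀ x ≤ 0, Q x = 0) (hv : ContinuousOn v (Icc c b)) :
    IntegrableOn (fun s => v s * -forwardAverage Q (deriv ψ) s) (Ici c) :=
  integrableOn_Ici_mul hv (hψ.continuous_forwardAverage_deriv hQ).neg fun t ht => by
    rw [hψ.forwardAverage_deriv_eq_zero hQ0 t ht, neg_zero]

theorem integrableOn_mul_add_forwardAverage_deriv (hψ : IsBump a b ψ) (hQ : Monotone Q)
    (hQ0 : ∀ x ≤ 0, Q x = 0) (hv : ContinuousOn v (Icc c b)) :
    IntegrableOn (fun s => v s * (ψ + forwardAverage Q (deriv ψ)) s) (Ici c) :=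
  integrableOn_Ici_mul hv (hψ.contDiff.continuous.add (hψ.continuous_forwardAverage_deriv hQ))
    fun t ht => by
      rw [Pi.add_apply, hψ.eq_zero_of_ge t ht, hψ.forwardAverage_deriv_eq_zero hQ0 t ht, add_zero]

theorem one_sub_mul_integral_le (hψ : IsBump a b ψ) (hQ : Monotone Q) (hQ0 : ∀ x ≤ 0, Q x = 0) :
    (1 - Q (b - a)) * ∫ t, ψ t ≤ ∫ s in Ici a, (ψ + forwardAverage Q (deriv ψ)) s := by
  have hint : IntegrableOn (forwardAverage Q (deriv ψ)) (Ici a) :=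
    integrableOn_Ici_of_eq_zero (hψ.continuous_forwardAverage_deriv hQ).continuousOn
      (hψ.forwardAverage_deriv_eq_zero hQ0)
  rw [integral_add' hψ.integrable.integrableOn hint, hψ.setIntegral_Ici,
    setIntegral_Ici_forwardAverage_deriv hQ.locallyIntegrable hQ0 hψ.contDiff_one
      hψ.hasCompactSupport hψ.eq_zero_of_ge, sub_mul, one_mul, ← sub_eq_add_neg]
  exact sub_le_sub_left (forwardAverage_le_mul_integral hQ hψ.contDiff.continuous
    hψ.hasCompactSupport hψ.nonneg hψ.eq_zero_of_ge a) _

end IsBump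

end BumpAverage

section Testing

variable {k r ψ : ℝ → ℝ} {α a b L : ℝ} {T : EReal}

theorem deriv_forwardAverage {h : ℝ → ℝ} (hh : LocallyIntegrable h) (hψ : ContDiff ℝ 1 ψ)
    (hc : HasCompactSupport ψ) : deriv (forwardAverage h ψ) = forwardAverage h (deriv ψ) :=
  funext fun s => (hasDerivAt_forwardAverage hh hψ hc s).deriv

namespace IsSubresolvent

theorem forwardAverage_deriv_forwardAverage (hr : IsSubresolvent k L r)
    (hk : LocallyIntegrable k) (hψ : ContDiff ℝ 1 ψ) (hc : HasCompactSupport ψ) :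
    forwardAverage k (deriv (forwardAverage r ψ))
      = -(ψ + forwardAverage (sonineDefect k r) (deriv ψ)) := by
  have hψ' : Continuous (deriv ψ) := hψ.continuous_deriv le_rfl
  have hconv : k ⋆ r = rlKernel 1 - sonineDefect k r := (sub_sub_cancel _ _).symm
  rw [deriv_forwardAverage hr.locallyIntegrable hψ hc,
    ← forwardAverage_convolution hk hr.locallyIntegrable hr.hasCompactSupport
      hr.convolutionExists hψ' hc.deriv, hconv,
    forwardAverage_sub (locallyIntegrable_rlKernel one_pos)
      hr.monotone_sonineDefect.locallyIntegrable hψ' hc.deriv,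
    forwardAverage_rlKernel_one_deriv hψ hc, neg_add']

theorem mul_forwardAverage_le (hr : IsSubresolvent k L r) (hψ : ContDiff ℝ 1 ψ)
    (hc : HasCompactSupport ψ) (hψ0 : ∀ t, 0 ≤ ψ t) (s : ℝ) :
    L * forwardAverage r ψ s ≤ -forwardAverage (sonineDefect k r) (deriv ψ) s := by
  have hψ' : Continuous (deriv ψ) := hψ.continuous_deriv le_rfl
  have hQ := hr.monotone_sonineDefect.locallyIntegrable (μ := volume)
  have hθr : LocallyIntegrable (L • (rlKernel 1 ⋆ r)) := by
    simpa only [sub_sub_cancel] using hQ.sub hr.monotone_sonineDefect_sub.locallyIntegrable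
  have hprim : forwardAverage (L • (rlKernel 1 ⋆ r)) (deriv ψ) = L • -forwardAverage r ψ := by
    rw [forwardAverage_smul, forwardAverage_convolution (locallyIntegrable_rlKernel one_pos)
        hr.locallyIntegrable hr.hasCompactSupport hr.convolutionExists_one hψ' hc.deriv,
      ← deriv_forwardAverage hr.locallyIntegrable hψ hc, forwardAverage_rlKernel_one_deriv
        (contDiff_forwardAverage (n := 1) hr.locallyIntegrable hψ hc)
        (hasCompactSupport_forwardAverage hr.hasCompactSupport hc)]
  have hle := forwardAverage_deriv_nonpos hr.monotone_sonineDefect_sub hψ hc hψ0 s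
  rw [forwardAverage_sub hQ hθr hψ' hc.deriv, hprim] at hle
  simp only [Pi.sub_apply, Pi.smul_apply, Pi.neg_apply, smul_eq_mul] at hle
  linarith

theorem forwardAverage_eq_zero_of_ge (hr : IsSubresolvent k L r) (hψ : IsBump a b ψ) (t : ℝ)
    (ht : b ≤ t) : forwardAverage r ψ t = 0 :=
  forwardAverage_eq_zero hr.eq_zero_of_nonpos hψ.eq_zero_of_ge ht

theorem integrableOn_mul_forwardAverage (hr : IsSubresolvent k L r) (hψ : IsBump a b ψ) {c : ℝ}
    {v : ℝ → ℝ} (hv : ContinuousOn v (Icc c b)) :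
    IntegrableOn (fun s => v s * forwardAverage r ψ s) (Ici c) :=
  integrableOn_Ici_mul hv (continuous_forwardAverage hr.locallyIntegrable hψ.contDiff.continuous
    hψ.hasCompactSupport) (hr.forwardAverage_eq_zero_of_ge hψ)

theorem exists_testFunction (hr : IsSubresolvent k L r) (hψ : IsBump a b ψ)
    (hbT : (b : EReal) < T) : ∃ φ : 𝓓(past T, ℝ), ⇑φ = forwardAverage r ψ := by
  have hsupp : tsupport (forwardAverage r ψ) ⊆ Iic b := by
    refine closure_minimal (fun s hs => ?_) isClosed_Iic
    by_contra hsb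
    exact hs (hr.forwardAverage_eq_zero_of_ge hψ s (le_of_not_ge hsb))
  exact ⟨
    { toFun := forwardAverage r ψ
      contDiff' := contDiff_forwardAverage hr.locallyIntegrable hψ.contDiff hψ.hasCompactSupport
      hasCompactSupport' :=
        hasCompactSupport_forwardAverage hr.hasCompactSupport hψ.hasCompactSupport
      tsupport_subset' := fun s hs => (EReal.coe_le_coe_iff.2 (hsupp hs)).trans_lt hbT }, rfl⟩

theorem caputo_eq (hr : IsSubresolvent (rlKernel (1 - α)) L r) (hα₀ : α ≠ 0) (hα₁ : α < 1)
    (hψ : ContDiff ℝ 1 ψ) (hc : HasCompactSupport ψ) {φ : 𝓓(past T, ℝ)}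
    (hφ : ⇑φ = forwardAverage r ψ) (u₀ : ℝ) (u : ℝ → ℝ) :
    caputo α u₀ u φ = ∫ s in Ici 0, (u s - u₀)
      * (ψ + forwardAverage (sonineDefect (rlKernel (1 - α)) r) (deriv ψ)) s := by
  rw [caputo_eq_setIntegral hα₀ hα₁, hφ, hr.forwardAverage_deriv_forwardAverage
    (locallyIntegrable_rlKernel (sub_pos.2 hα₁)) hψ hc]
  simp only [Pi.neg_apply, neg_neg]

theorem setIntegral_mul_le_of_distribLE_caputo (hr : IsSubresolvent (rlKernel (1 - α)) L r)
    (hα₀ : α ≠ 0) (hα₁ : α < 1) (hψ : IsBump a b ψ) (hbT : (b : EReal) < T) {u₀ : ℝ}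
    {u v : ℝ → ℝ} (h : DistribLE (T := T) (ofFunction v) (caputo α u₀ u)) :
    ∫ s in Ici 0, v s * forwardAverage r ψ s ≤ ∫ s in Ici 0, (u s - u₀)
      * (ψ + forwardAverage (sonineDefect (rlKernel (1 - α)) r) (deriv ψ)) s := by
  obtain ⟨φ, hφ⟩ := hr.exists_testFunction hψ hbT
  have hle := h φ fun t => hφ ▸ forwardAverage_nonneg hr.nonneg hψ.nonneg t
  rwa [ofFunction, hr.caputo_eq hα₀ hα₁ hψ.contDiff_one hψ.hasCompactSupport hφ,
    hφ] at hle

theorem setIntegral_mul_le_of_caputo_distribLE (hr : IsSubresolvent (rlKernel (1 - α)) L r)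
    (hα₀ : α ≠ 0) (hα₁ : α < 1) (hψ : IsBump a b ψ) (hbT : (b : EReal) < T) {u₀ : ℝ}
    {u v : ℝ → ℝ} (h : DistribLE (T := T) (caputo α u₀ u) (ofFunction v)) :
    ∫ s in Ici 0, (u s - u₀)
        * (ψ + forwardAverage (sonineDefect (rlKernel (1 - α)) r) (deriv ψ)) s
      ≤ ∫ s in Ici 0, v s * forwardAverage r ψ s := by
  obtain ⟨φ, hφ⟩ := hr.exists_testFunction hψ hbT
  have hle := h φ fun t => hφ ▸ forwardAverage_nonneg hr.nonneg hψ.nonneg t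
  rwa [ofFunction, hr.caputo_eq hα₀ hα₁ hψ.contDiff_one hψ.hasCompactSupport hφ,
    hφ] at hle

end IsSubresolvent

end Testing

section Gronwall

variable {Q w ψ : ℝ → ℝ} {a b C M : ℝ}

theorem setIntegral_posPart_mul_le (hQ : Monotone Q) (hQ0 : ∀ x ≤ 0, Q x = 0) (ha : 0 ≤ a)
    (hw : ContinuousOn w (Icc 0 b)) (hwa : ∀ t ∈ Icc 0 a, w t ≤ 0) (hM : 0 ≤ M)
    (hwM : ∀ t ∈ Icc a b, max (w t) 0 ≤ M) (hψ : IsBump a b ψ) :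
    ∫ s in Ici 0, max (w s) 0 * -forwardAverage Q (deriv ψ) s ≤ M * (Q (b - a) * ∫ t, ψ t) := by
  have hA0 (s : ℝ) : 0 ≤ -forwardAverage Q (deriv ψ) s := neg_nonneg.2
    (forwardAverage_deriv_nonpos hQ hψ.contDiff_one hψ.hasCompactSupport hψ.nonneg s)
  have hpos : ContinuousOn (fun s => max (w s) 0) (Icc a b) :=
    (hw.mono (Icc_subset_Icc_left ha)).sup continuousOn_const
  calc ∫ s in Ici 0, max (w s) 0 * -forwardAverage Q (deriv ψ) s
      = ∫ s in Ici a, max (w s) 0 * -forwardAverage Q (deriv ψ) s :=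
        setIntegral_eq_of_subset_of_forall_sdiff_eq_zero measurableSet_Ici (Ici_subset_Ici.2 ha)
          fun s hs => by rw [max_eq_right (hwa s ⟨hs.1, (not_le.1 hs.2).le⟩), zero_mul]
    _ ≤ ∫ s in Ici a, M * -forwardAverage Q (deriv ψ) s := by
        refine setIntegral_mono_on (hψ.integrableOn_mul_neg_forwardAverage_deriv hQ hQ0 hpos)
          (hψ.integrableOn_mul_neg_forwardAverage_deriv hQ hQ0 continuousOn_const)
          measurableSet_Ici fun s hs => ?_
        rcases le_total b s with hb | hb
        · rw [hψ.forwardAverage_deriv_eq_zero hQ0 s hb, neg_zero, mul_zero, mul_zero]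
        · exact mul_le_mul_of_nonneg_right (hwM s ⟨hs, hb⟩) (hA0 s)
    _ = M * forwardAverage Q ψ a := by
        rw [integral_const_mul, integral_neg, setIntegral_Ici_forwardAverage_deriv
          hQ.locallyIntegrable hQ0 hψ.contDiff_one hψ.hasCompactSupport hψ.eq_zero_of_ge, neg_neg]
    _ ≤ M * (Q (b - a) * ∫ t, ψ t) := mul_le_mul_of_nonneg_left
        (forwardAverage_le_mul_integral hQ hψ.contDiff.continuous hψ.hasCompactSupport hψ.nonneg
          hψ.eq_zero_of_ge a) hM

theorem nonpos_of_setIntegral_mul_isBump_le_of_small (hQ : Monotone Q) (hQ0 : ∀ x ≤ 0, Q x = 0)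
    (ha : 0 ≤ a) (hab : a < b) (hw : ContinuousOn w (Icc 0 b)) (hwa : ∀ t ∈ Icc 0 a, w t ≤ 0)
    (hC : 0 ≤ C) (hsmall : C * Q (b - a) < 1)
    (H : ∀ ψ, IsBump 0 b ψ → ∫ s in Ici 0, w s * ψ s
      ≤ C * ∫ s in Ici 0, max (w s) 0 * -forwardAverage Q (deriv ψ) s) :
    ∀ t ∈ Icc a b, w t ≤ 0 := by
  obtain ⟨x, hx, hmax⟩ := isCompact_Icc.exists_isMaxOn (nonempty_Icc.2 hab.le)
    ((hw.mono (Icc_subset_Icc_left ha)).sup continuousOn_const (g := fun _ => (0 : ℝ)))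
  set M := max (w x) 0
  have hM : 0 ≤ M := le_max_right _ _
  have hQM : 0 ≤ C * M * Q (b - a) :=
    mul_nonneg (mul_nonneg hC hM) ((hQ0 0 le_rfl).ge.trans (hQ (sub_nonneg.2 hab.le)))
  have hbound : ∀ t ∈ Icc a b, w t ≤ C * M * Q (b - a) := by
    refine le_of_setIntegral_mul_isBump_le ha hab hw fun ψ hψ => ?_
    calc ∫ s in Ici 0, w s * ψ s
        ≤ C * ∫ s in Ici 0, max (w s) 0 * -forwardAverage Q (deriv ψ) s :=
          H ψ (hψ.mono ha le_rfl)
      _ ≤ C * (M * (Q (b - a) * ∫ t, ψ t)) := mul_le_mul_of_nonneg_left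
          (setIntegral_posPart_mul_le hQ hQ0 ha hw hwa hM hmax hψ) hC
      _ = C * M * Q (b - a) * ∫ t, ψ t := by ring
  have hM0 : M ≤ 0 := by
    have hself : M ≤ C * M * Q (b - a) := max_le (hbound x hx) hQM
    nlinarith
  exact fun t ht => (le_max_left _ _).trans ((hmax ht).trans hM0)

theorem nonpos_of_setIntegral_mul_isBump_le (hQ : Monotone Q) (hQ0 : ∀ x ≤ 0, Q x = 0)
    (hlim : Tendsto Q (𝓝[>] 0) (𝓝 0)) (hw : ContinuousOn w (Icc 0 b)) (hw0 : w 0 ≤ 0)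
    (hC : 0 ≤ C)
    (H : ∀ ψ, IsBump 0 b ψ → ∫ s in Ici 0, w s * ψ s
      ≤ C * ∫ s in Ici 0, max (w s) 0 * -forwardAverage Q (deriv ψ) s) :
    ∀ t ∈ Icc 0 b, w t ≤ 0 := by
  have hCQ : Tendsto (fun x => C * Q x) (𝓝[>] 0) (𝓝 0) := by simpa using hlim.const_mul C
  obtain ⟨η, hη, hpos⟩ := ((hCQ.eventually_lt_const one_pos).and self_mem_nhdsWithin).exists
  have hsteps (n : ℕ) : ∀ t ∈ Icc 0 b, t ≤ n * η → w t ≤ 0 := by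
    induction n with
    | zero =>
      intro t ht htn
      rwa [le_antisymm (by simpa using htn) ht.1]
    | succ n ih =>
      intro t ht htn
      rcases le_or_gt t (n * η) with htη | htη
      · exact ih t ht htη
      set a := n * η
      set e := min (a + η) b
      have hte : t ≤ e := le_min (by push_cast at htn; linarith) ht.2
      have heb : e ≤ b := min_le_right _ _
      have hQe : Q (e - a) ≤ Q η := hQ (by linarith [min_le_left (a + η) b])
      exact nonpos_of_setIntegral_mul_isBump_le_of_small hQ hQ0 (by positivity)
        (htη.trans_le hte) (hw.mono (Icc_subset_Icc_right heb))
        (fun s hs => ih s ⟨hs.1, hs.2.trans (htη.le.trans ht.2)⟩ hs.2) hC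
        ((mul_le_mul_of_nonneg_left hQe hC).trans_lt hη)
        (fun ψ hψ => H ψ (hψ.mono le_rfl heb)) t ⟨htη.le, hte⟩
  intro t ht
  obtain ⟨n, hn⟩ := exists_nat_ge (t / η)
  exact hsteps n t ht ((div_le_iff₀ hpos).1 hn)

end Gronwall

section Comparison

variable {k r w ψ : ℝ → ℝ} {α a b L : ℝ}

namespace IsSubresolvent

theorem sonineDefect_eq_zero (hr : IsSubresolvent k L r) (hk : ∀ x ≤ 0, k x = 0) (x : ℝ)
    (hx : x ≤ 0) : sonineDefect k r x = 0 :=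
  sonineDefect_of_nonpos hk hr.eq_zero_of_nonpos hx

theorem mul_abs_forwardAverage_add_le (hr : IsSubresolvent k L r) (hψ : IsBump a b ψ) (x s : ℝ) :
    L * (|x| * forwardAverage r ψ s) + x * -forwardAverage (sonineDefect k r) (deriv ψ) s
      ≤ 2 * (max x 0 * -forwardAverage (sonineDefect k r) (deriv ψ) s) := by
  have habs : |x| + x = 2 * max x 0 := by
    rcases le_total 0 x with hx | hx
    · rw [abs_of_nonneg hx, max_eq_left hx, two_mul]
    · rw [abs_of_nonpos hx, max_eq_right hx, neg_add_cancel, mul_zero]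
  have hle := mul_le_mul_of_nonneg_left
    (hr.mul_forwardAverage_le hψ.contDiff_one hψ.hasCompactSupport hψ.nonneg s) (abs_nonneg x)
  rw [← mul_assoc 2, ← habs, add_mul]
  linarith

theorem setIntegral_mul_isBump_le (hr : IsSubresolvent k L r) (hk : ∀ x ≤ 0, k x = 0)
    (hw : ContinuousOn w (Icc 0 b)) (hw0 : w 0 ≤ 0) (hψ : IsBump 0 b ψ)
    (h : ∫ s in Ici 0, (w s - w 0) * (ψ + forwardAverage (sonineDefect k r) (deriv ψ)) s
      ≤ L * ∫ s in Ici 0, |w s| * forwardAverage r ψ s) :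
    ∫ s in Ici 0, w s * ψ s ≤ w 0 * (1 - sonineDefect k r b) * (∫ t, ψ t)
      + 2 * ∫ s in Ici 0, max (w s) 0 * -forwardAverage (sonineDefect k r) (deriv ψ) s := by
  set A := forwardAverage (sonineDefect k r) (deriv ψ)
  have hQ := hr.monotone_sonineDefect
  have hQ0 := hr.sonineDefect_eq_zero hk
  have hint {v : ℝ → ℝ} (hv : ContinuousOn v (Icc 0 b)) :
      IntegrableOn (fun s => v s * -A s) (Ici 0) :=
    hψ.integrableOn_mul_neg_forwardAverage_deriv hQ hQ0 hv
  have hsplit : ∫ s in Ici 0, w s * ψ s = (∫ s in Ici 0, (w s - w 0) * (ψ + A) s)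
      + w 0 * (∫ s in Ici 0, (ψ + A) s) + ∫ s in Ici 0, w s * -A s := by
    have h₁ : IntegrableOn (fun s => (w s - w 0) * (ψ + A) s) (Ici 0) :=
      hψ.integrableOn_mul_add_forwardAverage_deriv hQ hQ0 (hw.sub continuousOn_const)
    have h₂ : IntegrableOn (fun s => w 0 * (ψ + A) s) (Ici 0) :=
      hψ.integrableOn_mul_add_forwardAverage_deriv hQ hQ0 continuousOn_const
    have h₁₂ : IntegrableOn (fun s => (w s - w 0) * (ψ + A) s + w 0 * (ψ + A) s) (Ici 0) :=
      h₁.add h₂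
    rw [← integral_const_mul, ← integral_add h₁ h₂, ← integral_add h₁₂ (hint hw)]
    refine integral_congr_ae (Eventually.of_forall fun s => ?_)
    simp only [Pi.add_apply]
    ring
  have habsorb : L * (∫ s in Ici 0, |w s| * forwardAverage r ψ s) + (∫ s in Ici 0, w s * -A s)
      ≤ 2 * ∫ s in Ici 0, max (w s) 0 * -A s := by
    have hφ := (hr.integrableOn_mul_forwardAverage hψ hw.abs).const_mul L
    rw [← integral_const_mul, ← integral_const_mul, ← integral_add hφ (hint hw)]
    exact integral_mono (hφ.add (hint hw)) ((hint (hw.sup continuousOn_const)).const_mul 2)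
      fun s => hr.mul_abs_forwardAverage_add_le hψ (w s) s
  have hmass := mul_le_mul_of_nonpos_left (hψ.one_sub_mul_integral_le hQ hQ0) hw0
  rw [sub_zero] at hmass
  linarith

theorem le_mul_of_setIntegral_mul_le (hr : IsSubresolvent k L r) (hk : ∀ x ≤ 0, k x = 0)
    (hb : 0 < b) (hw : ContinuousOn w (Icc 0 b)) (hw0 : w 0 ≤ 0)
    (h : ∀ ψ, IsBump 0 b ψ →
      ∫ s in Ici 0, (w s - w 0) * (ψ + forwardAverage (sonineDefect k r) (deriv ψ)) s
        ≤ L * ∫ s in Ici 0, |w s| * forwardAverage r ψ s) :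
    ∀ t ∈ Icc 0 b, w t ≤ w 0 * (1 - sonineDefect k r b) := by
  have hQ0 := hr.sonineDefect_eq_zero hk
  have henergy (ψ : ℝ → ℝ) (hψ : IsBump 0 b ψ) :=
    hr.setIntegral_mul_isBump_le hk hw hw0 hψ (h ψ hψ)
  have hcoef : w 0 * (1 - sonineDefect k r b) ≤ 0 := mul_nonpos_of_nonpos_of_nonneg hw0
    (sub_nonneg.2 (sonineDefect_lt_one hb (hr.convolution_pos b hb)).le)
  have hnonpos : ∀ t ∈ Icc 0 b, w t ≤ 0 :=
    nonpos_of_setIntegral_mul_isBump_le hr.monotone_sonineDefect hQ0 hr.tendsto_sonineDefect hw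
      hw0 zero_le_two fun ψ hψ => (henergy ψ hψ).trans
        (add_le_of_nonpos_left (mul_nonpos_of_nonpos_of_nonneg hcoef (integral_nonneg hψ.nonneg)))
  refine le_of_setIntegral_mul_isBump_le le_rfl hb hw fun ψ hψ => (henergy ψ hψ).trans_eq ?_
  rw [add_eq_left, setIntegral_eq_zero_of_forall_eq_zero, mul_zero]
  intro s hs
  rcases le_total b s with hbs | hbs
  · rw [hψ.forwardAverage_deriv_eq_zero hQ0 s hbs, neg_zero, mul_zero]
  · rw [max_eq_right (hnonpos s ⟨hs, hbs⟩), zero_mul]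

theorem setIntegral_sub_mul_le (hr : IsSubresolvent (rlKernel (1 - α)) L r) (hα₀ : α ≠ 0)
    (hα₁ : α < 1) {Ty Tz : EReal} (hbTy : (b : EReal) < Ty) (hbTz : (b : EReal) < Tz)
    {y z v v' : ℝ → ℝ} (hy : ContinuousOn y (Icc 0 b)) (hz : ContinuousOn z (Icc 0 b))
    (hv : ContinuousOn v (Icc 0 b)) (hv' : ContinuousOn v' (Icc 0 b)) {y₀ z₀ : ℝ}
    (hyv : DistribLE (T := Ty) (ofFunction v) (caputo α y₀ y))
    (hzv : DistribLE (T := Tz) (caputo α z₀ z) (ofFunction v'))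
    (hlip : ∀ s ∈ Icc 0 b, v' s - v s ≤ L * |z s - y s|) (hψ : IsBump 0 b ψ) :
    ∫ s in Ici 0, (z s - y s - (z₀ - y₀))
        * (ψ + forwardAverage (sonineDefect (rlKernel (1 - α)) r) (deriv ψ)) s
      ≤ L * ∫ s in Ici 0, |z s - y s| * forwardAverage r ψ s := by
  set D := ψ + forwardAverage (sonineDefect (rlKernel (1 - α)) r) (deriv ψ)
  have hintD {u : ℝ → ℝ} (hu : ContinuousOn u (Icc 0 b)) (u₀ : ℝ) :
      IntegrableOn (fun s => (u s - u₀) * D s) (Ici 0) :=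
    hψ.integrableOn_mul_add_forwardAverage_deriv hr.monotone_sonineDefect
      (hr.sonineDefect_eq_zero fun _ => rlKernel_of_nonpos _) (hu.sub continuousOn_const)
  have hint {u : ℝ → ℝ} (hu : ContinuousOn u (Icc 0 b)) :
      IntegrableOn (fun s => u s * forwardAverage r ψ s) (Ici 0) :=
    hr.integrableOn_mul_forwardAverage hψ hu
  calc ∫ s in Ici 0, (z s - y s - (z₀ - y₀)) * D s
      = (∫ s in Ici 0, (z s - z₀) * D s) - ∫ s in Ici 0, (y s - y₀) * D s := by
        rw [← integral_sub (hintD hz z₀) (hintD hy y₀)]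
        refine integral_congr_ae (Eventually.of_forall fun s => ?_)
        ring
    _ ≤ (∫ s in Ici 0, v' s * forwardAverage r ψ s) - ∫ s in Ici 0, v s * forwardAverage r ψ s :=
        sub_le_sub (hr.setIntegral_mul_le_of_caputo_distribLE hα₀ hα₁ hψ hbTz hzv)
          (hr.setIntegral_mul_le_of_distribLE_caputo hα₀ hα₁ hψ hbTy hyv)
    _ = ∫ s in Ici 0, (v' s - v s) * forwardAverage r ψ s := by
        simp only [sub_mul, integral_sub (hint hv') (hint hv)]
    _ ≤ ∫ s in Ici 0, L * (|z s - y s| * forwardAverage r ψ s) := by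
        refine setIntegral_mono_on (hint (hv'.sub hv)) ((hint (hz.sub hy).abs).const_mul L)
          measurableSet_Ici fun s hs => ?_
        rcases le_total b s with hbs | hbs
        · simp only [hr.forwardAverage_eq_zero_of_ge hψ s hbs, mul_zero, le_refl]
        · rw [← mul_assoc]
          exact mul_le_mul_of_nonneg_right (hlip s ⟨hs, hbs⟩)
            (forwardAverage_nonneg hr.nonneg hψ.nonneg s)
    _ = L * ∫ s in Ici 0, |z s - y s| * forwardAverage r ψ s := integral_const_mul _ _

end IsSubresolvent

theorem exists_pos_sub_le_mul_of_caputo (hα₀ : 0 < α) (hα₁ : α < 1) (hL : 0 ≤ L) (hb : 0 < b)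
    {Ty Tz : EReal} (hbTy : (b : EReal) < Ty) (hbTz : (b : EReal) < Tz)
    {y z v v' : ℝ → ℝ} (hy : ContinuousOn y (Icc 0 b)) (hz : ContinuousOn z (Icc 0 b))
    (hv : ContinuousOn v (Icc 0 b)) (hv' : ContinuousOn v' (Icc 0 b))
    (hyv : DistribLE (T := Ty) (ofFunction v) (caputo α (y 0) y))
    (hzv : DistribLE (T := Tz) (caputo α (z 0) z) (ofFunction v'))
    (hlip : ∀ s ∈ Icc 0 b, v' s - v s ≤ L * |z s - y s|) (h₀ : z 0 ≤ y 0) :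
    ∃ γ > 0, ∀ t ∈ Icc 0 b, z t - y t ≤ (z 0 - y 0) * γ := by
  obtain ⟨r, hr⟩ := exists_isSubresolvent_rlKernel hα₀ hα₁ hL
  exact ⟨1 - sonineDefect (rlKernel (1 - α)) r b,
    sub_pos.2 (sonineDefect_lt_one hb (hr.convolution_pos b hb)),
    hr.le_mul_of_setIntegral_mul_le (w := fun s => z s - y s)
      (fun _ => rlKernel_of_nonpos _) hb (hz.sub hy)
      (sub_nonpos.2 h₀) fun ψ hψ => hr.setIntegral_sub_mul_le hα₀.ne' hα₁ hbTy hbTz hy hz hv hv'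
        hyv hzv hlip hψ⟩

end Comparison

section Lipschitz

variable {f : ℝ → ℝ → ℝ} {y z : ℝ → ℝ} {b t : ℝ}

theorem continuousOn_comp_graph (hf : ContinuousOn (fun p : ℝ × ℝ => f p.1 p.2) (Ici 0 ×ˢ univ))
    (hy : ContinuousOn y (Icc 0 b)) : ContinuousOn (fun s => f s (y s)) (Icc 0 b) :=
  hf.comp (f := fun s => (s, y s)) (continuousOn_id.prodMk hy) fun _ hs => ⟨hs.1, mem_univ _⟩

theorem exists_eventually_abs_sub_le_of_ne {g h : ℝ → ℝ} {l : Filter ℝ} {g₀ h₀ : ℝ}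
    (hg : Tendsto g l (𝓝 g₀)) (hh : Tendsto h l (𝓝 h₀)) (hne : h₀ ≠ 0) :
    ∃ C : ℝ, ∀ᶠ s in l, |g s| ≤ C * |h s| := by
  refine ⟨|g₀ / h₀| + 1, ?_⟩
  filter_upwards [(hg.div hh hne).abs.eventually_lt_const (lt_add_one _), hh.eventually_ne hne]
    with s hlt hs
  rw [← div_le_iff₀ (abs_pos.2 hs), ← abs_div]
  exact hlt.le

theorem LocallyLipschitzInState.exists_eventually_abs_sub_le (hfLip : LocallyLipschitzInState f)
    (hf : ContinuousOn (fun p : ℝ × ℝ => f p.1 p.2) (Ici 0 ×ˢ univ))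
    (hy : ContinuousOn y (Icc 0 b)) (hz : ContinuousOn z (Icc 0 b)) (ht : t ∈ Icc 0 b) :
    ∃ L : ℝ, ∀ᶠ s in 𝓝[Icc 0 b] t, |f s (z s) - f s (y s)| ≤ L * |z s - y s| := by
  rcases eq_or_ne (z t) (y t) with hzy | hzy
  · obtain ⟨L, N, hN, hLN⟩ := hfLip t ht.1 (y t)
    refine ⟨L, ?_⟩
    filter_upwards [hLN.filter_mono (nhdsWithin_mono t Icc_subset_Ici_self), hy t ht hN,
      hz t ht (hzy ▸ hN)] with s hs hys hzs using hs.dist_le_mul _ hzs _ hys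
  · exact exists_eventually_abs_sub_le_of_ne
      ((continuousOn_comp_graph hf hz t ht).sub (continuousOn_comp_graph hf hy t ht))
      ((hz t ht).sub (hy t ht)) (sub_ne_zero.2 hzy)

theorem LocallyLipschitzInState.exists_abs_sub_le (hfLip : LocallyLipschitzInState f)
    (hf : ContinuousOn (fun p : ℝ × ℝ => f p.1 p.2) (Ici 0 ×ˢ univ))
    (hy : ContinuousOn y (Icc 0 b)) (hz : ContinuousOn z (Icc 0 b)) :
    ∃ L, 0 ≤ L ∧ ∀ s ∈ Icc 0 b, |f s (z s) - f s (y s)| ≤ L * |z s - y s| := by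
  have hmono {S : Set ℝ} {L L' : ℝ} (hLL : L ≤ L')
      (h : ∀ s ∈ S, |f s (z s) - f s (y s)| ≤ L * |z s - y s|) :
      ∀ s ∈ S, |f s (z s) - f s (y s)| ≤ L' * |z s - y s| := fun s hs =>
    (h s hs).trans (mul_le_mul_of_nonneg_right hLL (abs_nonneg _))
  refine isCompact_Icc.induction_on
    (p := fun S => ∃ L, 0 ≤ L ∧ ∀ s ∈ S, |f s (z s) - f s (y s)| ≤ L * |z s - y s|) ?_ ?_ ?_ ?_
  · exact ⟨0, le_rfl, fun s hs => hs.elim⟩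
  · rintro S S' hSS ⟨L, hL, h⟩
    exact ⟨L, hL, fun s hs => h s (hSS hs)⟩
  · rintro S S' ⟨L, hL, h⟩ ⟨L', -, h'⟩
    exact ⟨max L L', hL.trans (le_max_left _ _), fun s hs =>
      hs.elim (hmono (le_max_left _ _) h s) (hmono (le_max_right _ _) h' s)⟩
  · intro t ht
    obtain ⟨L, hL⟩ := hfLip.exists_eventually_abs_sub_le hf hy hz ht
    exact ⟨_, hL, max L 0, le_max_right _ _, hmono (le_max_left _ _) fun s hs => hs⟩

end Lipschitz

end FracComparison

end

theorem theorem3p1 (α : ℝ) (hα₀ : 0 < α) (hα₁ : α < 1)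
    (f : ℝ → ℝ → ℝ)
    (hf : ContinuousOn (fun p : ℝ × ℝ => f p.1 p.2) (Ici 0 ×ˢ univ))
    (hfLip : FracComparison.LocallyLipschitzInState f)
    (Ty Tz : EReal) (hTy : 0 < Ty) (hTz : 0 < Tz)
    (y z : ℝ → ℝ)
    (hy : ContinuousOn y (FracComparison.existInterval Ty))
    (hz : ContinuousOn z (FracComparison.existInterval Tz))
    (hyf : FracComparison.DistribLE (T := Ty)
      (FracComparison.ofFunction (fun t => f t (y t))) (FracComparison.caputo α (y 0) y))
    (hzf : FracComparison.DistribLE (T := Tz)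
      (FracComparison.caputo α (z 0) z) (FracComparison.ofFunction (fun t => f t (z t))))
    (h₀ : z 0 ≤ y 0) :
    (∀ t ∈ FracComparison.existInterval Ty ∩ FracComparison.existInterval Tz, z t ≤ y t) ∧
      (z 0 < y 0 →
        ∀ t ∈ FracComparison.existInterval Ty ∩ FracComparison.existInterval Tz, z t < y t) := by
  suffices h : ∀ t ∈ FracComparison.existInterval Ty ∩ FracComparison.existInterval Tz,
      ∃ γ > 0, z t - y t ≤ (z 0 - y 0) * γ by
    refine ⟨fun t ht => ?_, fun hlt t ht => ?_⟩ <;> obtain ⟨γ, hγ, hle⟩ := h t ht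
    · exact sub_nonpos.1 (hle.trans (mul_nonpos_of_nonpos_of_nonneg (sub_nonpos.2 h₀) hγ.le))
    · exact sub_neg.1 (hle.trans_lt (mul_neg_of_neg_of_pos (sub_neg.2 hlt) hγ))
  rintro t ⟨⟨ht0, htTy⟩, -, htTz⟩
  obtain ⟨b, htb, hb⟩ := EReal.lt_iff_exists_real_btwn.1 (lt_min htTy htTz)
  rw [EReal.coe_lt_coe_iff] at htb
  obtain ⟨hbTy, hbTz⟩ := lt_min_iff.1 hb
  have hIcc {T : EReal} (hbT : (b : EReal) < T) : Icc 0 b ⊆ FracComparison.existInterval T :=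
    fun s hs => ⟨hs.1, (EReal.coe_le_coe_iff.2 hs.2).trans_lt hbT⟩
  have hy' := hy.mono (hIcc hbTy)
  have hz' := hz.mono (hIcc hbTz)
  obtain ⟨L, hL, hlip⟩ := hfLip.exists_abs_sub_le hf hy' hz'
  obtain ⟨γ, hγ, hle⟩ := FracComparison.exists_pos_sub_le_mul_of_caputo hα₀ hα₁ hL
    (ht0.trans_lt htb) hbTy hbTz hy' hz' (FracComparison.continuousOn_comp_graph hf hy')
    (FracComparison.continuousOn_comp_graph hf hz') hyf hzf
    (fun s hs => (le_abs_self _).trans (hlip s hs)) h₀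
  exact ⟨γ, hγ, hle t ⟨ht0, htb.le⟩⟩
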